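/- Fix a $C$-sequence $\langle C_\alpha:\alpha<\omega_1\rangle$: each $C_\alpha$ is a cofinal subset of $\alpha$; if $\alpha$ is a limit ordinal, then $C_\alpha\cap\xi$ is finite for all $\xi<\alpha$; and $C_{\beta+1}=\{\beta\}$. For $\alpha\le\beta<\omega_1$ define recursively the upper trace by $U(\alpha,\alpha)=\emptyset$ and, for $\alpha<\beta$, $$U(\alpha,\beta)=U(\alpha,\min(C_\beta\setminus\alpha))\cup\{\beta\},$$ and the lower trace by $L(\alpha,\alpha)=\emptyset$ and, for $\alpha<\beta$, $$L(\alpha,\beta)=\big(L(\alpha,\min(C_\beta\setminus\alpha))\cup\{m\}\big)\setminus m,\qquad m=\max(C_\beta\cap\alpha),$$ where removing the ordinal $m$ means removing all ordinals smaller than $m$, and where $L(\alpha,\beta)=L(\alpha,\min(C_\beta\setminus\alpha))$ if $C_\beta\cap\alpha=\emptyset$. For $\alpha<\beta$ let $$e_\beta(\alpha)=\max\{|C_\xi\cap\alpha|:\xi\in U(\alpha,\beta)\},$$ and let $\operatorname{osc}(\alpha,\beta)$ be the number of $\zeta\in L(\alpha,\beta)\setminus\{\min L(\alpha,\beta)\}$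 such that $e_\alpha(\zeta^-)\le e_\beta(\zeta^-)$ and $e_\alpha(\zeta)>e_\beta(\zeta)$, where $\zeta^-$ is the immediate predecessor of $\zeta$ in $L(\alpha,\beta)$. Let $\operatorname{osc}(\cdot,\beta)$ denote the function $\xi\mapsto\operatorname{osc}(\xi,\beta)$ with domain $\beta$, and write $s\sqsubseteq t$ if the sequence $t$ end-extends $s$, that is, $\operatorname{dom}(s)\le\operatorname{dom}(t)$ and $t\restriction\operatorname{dom}(s)=s$. Let $S\subseteq\omega_1$ be stationary, and for each $\alpha\in S$ let $\beta_\alpha$ be given with $\alpha\le\beta_\alpha<\omega_1$. Then there is a stationary set $S'\subseteq S$ such that for all $\alpha<\gamma$ in $S'$: $$\operatorname{osc}(\cdot,\alpha)\sqsubseteq\operatorname{osc}(\cdot,\gamma)\restriction\alpha\iff\operatorname{osc}(\cdot,\beta_\alpha)\restriction\alpha\sqsubseteq\operatorname{osc}(\cdot,\beta_\gamma)\restriction\gamma.$$ -/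

import Mathlib

noncomputable section

namespace MinimalWalk

/-- The first uncountable ordinal, as the well-ordered type of all countable ordinals. -/
abbrev Omega1 : Type 1 := Set.Iio (Ordinal.omega.{0} 1)

/-- A `C`-sequence on the countable ordinals: `C α` is a cofinal subset of `α`; if `α` is a limit
ordinal, then `C α ∩ ξ` is finite for all `ξ < α`; and `C (β + 1) = {β}`. -/
structure CSequence where
  /-- the ladder on `α` -/
  C : Omega1 → Set Omega1
  subset_Iio : ∀ α, C α ⊆ Set.Iio α
  cofinal : ∀ α, ∀ ξ < α, ∃ η ∈ C α, ξ ≤ η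
  finite_of_limit : ∀ α : Omega1, Order.IsSuccLimit (α : Ordinal.{0}) →
    ∀ ξ : Omega1, ξ < α → (C α ∩ Set.Iio ξ).Finite
  eq_of_succ : ∀ α β : Omega1, (α : Ordinal.{0}) = (β : Ordinal.{0}) + 1 → C α = {β}

namespace CSequence

variable (c : CSequence)

theorem finite_inter {α β : Omega1} (h : α < β) : (c.C β ∩ Set.Iio α).Finite := by
  rcases Ordinal.zero_or_succ_or_isSuccLimit (β : Ordinal.{0}) with h0 | ⟨γ, hγ⟩ | hl
  · exact absurd (h0 ▸ (show (α : Ordinal.{0}) < (β : Ordinal.{0}) from h)) not_lt_zero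
  · have hlt : γ < (β : Ordinal.{0}) := by
      rw [← hγ]; exact Order.lt_succ γ
    rw [c.eq_of_succ β ⟨γ, Set.mem_Iio.2 (lt_trans hlt (Set.mem_Iio.1 β.2))⟩
      (hγ.symm.trans (Order.succ_eq_add_one γ))]
    exact (Set.finite_singleton _).inter_of_left _
  · exact c.finite_of_limit β hl α h

/-- The finite set `C β ∩ α`, for `α < β`. -/
def cut (α β : Omega1) (h : α < β) : Finset Omega1 := (c.finite_inter h).toFinset

theorem diff_nonempty {α β : Omega1} (h : α < β) : (c.C β \ Set.Iio α).Nonempty := by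
  obtain ⟨η, hη, hle⟩ := c.cofinal β α h
  exact ⟨η, hη, not_lt.2 hle⟩

/-- One step of the walk from `β` down to `α < β`: the ordinal `min (C β \ α)`. -/
def step (α β : Omega1) (h : α < β) : Omega1 :=
  (wellFounded_lt (α := Omega1)).min (c.C β \ Set.Iio α) (c.diff_nonempty h)

theorem step_lt {α β : Omega1} (h : α < β) : c.step α β h < β :=
  c.subset_Iio β (WellFounded.min_mem _ _ (c.diff_nonempty h)).1

/-- The upper trace: `U(α, α) = ∅` and `U(α, β) = U(α, min (C β \ α)) ∪ {β}` for `α < β`. -/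
def upperTrace (α β : Omega1) : Finset Omega1 :=
  if h : α < β then insert β (upperTrace α (c.step α β h)) else ∅
termination_by (wellFounded_lt (α := Omega1)).wrap β
decreasing_by exact c.step_lt h

/-- The lower trace: `L(α, α) = ∅`, and for `α < β`
`L(α, β) = (L(α, min (C β \ α)) ∪ {m}) \ m` with `m = max (C β ∩ α)`, where the ordinal `m` is
the set of all smaller ordinals. If `C β ∩ α` is empty, this step contributes nothing. -/
def lowerTrace (α β : Omega1) : Finset Omega1 :=
  if h : α < β then
    if hne : (c.cut α β h).Nonempty then
      (insert ((c.cut α β h).max' hne) (lowerTrace α (c.step α β h))).filter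
        (fun ξ => (c.cut α β h).max' hne ≤ ξ)
    else lowerTrace α (c.step α β h)
  else ∅
termination_by (wellFounded_lt (α := Omega1)).wrap β
decreasing_by all_goals exact c.step_lt h

/-- The maximum weight function `e_β(α) = max {|C ξ ∩ α| : ξ ∈ U(α, β)}`, for `α < β`. All the
sets `C ξ ∩ α` here are finite, because every `ξ ∈ U(α, β)` is greater than `α`. -/
def e (β α : Omega1) : ℕ :=
  (c.upperTrace α β).sup (fun ξ => (c.C ξ ∩ Set.Iio α).ncard)

/-- `ξ` is the immediate predecessor of `ζ` in the finite set `L`. -/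
def IsPred (L : Finset Omega1) (ξ ζ : Omega1) : Prop :=
  ξ ∈ L ∧ ξ < ζ ∧ ∀ η ∈ L, η < ζ → η ≤ ξ

open Classical in
/-- The oscillation function: the number of `ζ ∈ L(α, β)` other than the minimum, with immediate
predecessor `ξ` in `L(α, β)`, such that `e_α(ξ) ≤ e_β(ξ)` and `e_α(ζ) > e_β(ζ)`. The minimum is
the only element of `L(α, β)` without an immediate predecessor. -/
def osc (α β : Omega1) : ℕ :=
  ((c.lowerTrace α β).filter (fun ζ =>
    ∃ ξ, IsPred (c.lowerTrace α β) ξ ζ ∧ c.e α ξ ≤ c.e β ξ ∧ c.e β ζ < c.e α ζ)).card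

end CSequence

/-- A sequence of natural numbers whose domain is a countable ordinal. -/
structure NatSeq where
  /-- the domain -/
  dom : Omega1
  /-- the values on the domain -/
  val : Set.Iio dom → ℕ

/-- The restriction of `s` to the ordinals below `α`. -/
def NatSeq.restrict (s : NatSeq) (α : Omega1) : NatSeq where
  dom := min s.dom α
  val := fun ζ => s.val ⟨ζ.1, lt_of_lt_of_le (Set.mem_Iio.1 ζ.2) (min_le_left _ _)⟩

/-- `s ⊑ t`: the sequence `t` end-extends `s` (equality allowed). -/
def NatSeq.IsInitial (s t : NatSeq) : Prop :=
  ∃ h : s.dom ≤ t.dom, ∀ ζ : Set.Iio s.dom, s.val ζ = t.val ⟨ζ.1, lt_of_lt_of_le (Set.mem_Iio.1 ζ.2) h⟩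

/-- The sequence `osc(·, β)` with domain `β`. -/
def CSequence.oscSeq (c : CSequence) (β : Omega1) : NatSeq where
  dom := β
  val := fun ζ => c.osc ζ.1 β

end MinimalWalk

end

/-!
The two sides of the equivalence are never true on a suitable stationary set: for every stationary `S`
and all `β α ≥ α` (`α ∈ S`), the nodes `osc(·, β α)↾α` of the tree of oscillation sequences contain
a stationary antichain (`CSequence.exists_isStationary_osc_ne`). The theorem follows by thinning out
`S` twice, for the family `β` and for the identity.

The antichain is found as follows. By coherence of the functions `e_β` and by pressing down, there is
an ordinal `b` such that, for `α` in a stationary set, `b` splits the walk from `β α` at `α`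
(`CSequence.Splits`): for `b < ξ < α` the lower trace `L(ξ, β α)` is `L(α, β α)` followed by `L(ξ, α)`,
and `e_{β α}` equals `e_α` on `[b, α)`. Further, `F = L(α, β α)` and `f = e_{β α}↾F` may be taken
independent of `α`. For `α < γ` in this set and `ξ < α` large enough, `L(ξ, β γ)` is then the
concatenation of `F`, of the nonempty set `G = L(α, γ)`, and of `L(ξ, α)`, while `L(ξ, β α)` is that
of `F` and `L(ξ, α)` only. So it is enough to find `ξ` for which the passage through `G` changes the
number of oscillations, that is, to prescribe the values of `e_ξ` on `F ∪ G` and at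
`m = min L(ξ, α) = max (C α ∩ ξ)`.

* If `F` is empty, `e_ξ(max G) = e_γ(max G)` and `e_ξ(m) > e_α(m)` give an oscillation at `m` that is
  not counted in `osc(ξ, β α) = osc(ξ, α)` (`CSequence.exists_osc_ne_of_empty`).
* If `F` is not empty, `e_ξ = f` on `F`, `e_ξ > e_γ` on `G` and `e_ξ(m) = e_α(m)` give exactly one new
  oscillation, at `min G` (`CSequence.exists_osc_ne_of_nonempty`).

Such values are first realised by some `e_a` with `a ≥ α`: large values exist because the functions
`e_a` are finite-to-one (`CSequence.finite_e_le`, `CSequence.exists_forall_e_gt`), and values equal to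
those of `e_α` by coherence. They are then reflected to `ξ < α`. The point is that `m` depends on
`ξ`. Since `α` is a limit of a club `E` of reflecting ordinals, while `C α` has order type `ω`, there
are consecutive elements of `C α` with some `δ ∈ E` between them (`CSequence.exists_ladder_gap`). If
`m` is the smaller one, then reflecting at `δ` gives `ξ` with `m < ξ < δ`, and `max (C α ∩ ξ)` is
indeed `m`.
-/

namespace MinimalWalk

open Set Order Cardinal

/-! ### Club and stationary subsets of `ω₁` -/

theorem countable_Iio (x : Omega1) : (Iio x).Countable := by
  have h : (Iio (x : Ordinal.{0})).Countable := by
    have hx : (x : Ordinal.{0}).card < ℵ₁ := by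
      have h2 := Set.mem_Iio.1 x.2
      exact Cardinal.lt_ord.1 (by rwa [Cardinal.ord_aleph])
    rw [← Cardinal.le_aleph0_iff_set_countable, Cardinal.mk_Iio_ordinal, ← Cardinal.lift_aleph0.{1, 0},
      Cardinal.lift_le]
    exact Cardinal.lt_aleph_one_iff.1 hx
  refine (h.preimage Subtype.val_injective).mono fun y hy => ?_
  exact hy

theorem exists_gt_of_countable {A : Set Omega1} (hA : A.Countable) : ∃ c, ∀ a ∈ A, a < c := by
  have := hA.to_subtype
  have h : ∀ a : A, Order.succ (a.1.1 : Ordinal.{0}) < Ordinal.omega.{0} 1 := fun a =>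
    (Cardinal.isSuccLimit_omega 1).succ_lt (Set.mem_Iio.1 a.1.2)
  have : Small.{0} A := Countable.toSmall A
  refine ⟨⟨⨆ a : A, Order.succ (a.1.1 : Ordinal.{0}), Set.mem_Iio.2
    (Ordinal.iSup_lt_omega_one h)⟩, fun a ha => ?_⟩
  exact (Order.lt_succ (a : Ordinal.{0})).trans_le
    (le_ciSup (f := fun a : A => Order.succ (a.1.1 : Ordinal.{0}))
      ⟨_, by rintro _ ⟨a, rfl⟩; exact (h a).le⟩ ⟨a, ha⟩)

instance : Nonempty Omega1 := ⟨⟨0, Ordinal.omega_pos 1⟩⟩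

instance : NoMaxOrder Omega1 where
  exists_gt a := by
    obtain ⟨c, hc⟩ := exists_gt_of_countable (countable_singleton a)
    exact ⟨c, hc a rfl⟩

theorem cof_Omega1_ne : Order.cof Omega1 ≠ ℵ₀ := by
  intro h
  obtain ⟨A, hA, hA'⟩ := Order.exists_cof_eq Omega1
  have hc : A.Countable := by
    rw [← Cardinal.le_aleph0_iff_set_countable, hA', h]
  obtain ⟨c, hc⟩ := exists_gt_of_countable hc
  obtain ⟨b, hb, hcb⟩ := hA c
  exact (hc b hb).not_ge hcb

theorem exists_mem_gt {t : Set Omega1} (ht : IsCofinal t) (x : Omega1) : ∃ y ∈ t, x < y := by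
  obtain ⟨z, hz⟩ := exists_gt x
  obtain ⟨y, hy, hzy⟩ := ht z
  exact ⟨y, hy, hz.trans_le hzy⟩

theorem isClub_Ioi (x : Omega1) : IsClub (Ioi x) := by
  refine ⟨fun d hd hne _ a ha => ?_, fun z => ?_⟩
  · obtain ⟨y, hy⟩ := hne
    exact (hd hy).trans_le (ha.1 hy)
  · obtain ⟨y, hy⟩ := exists_gt (max x z)
    exact ⟨y, (le_max_left _ _).trans_lt hy, ((le_max_right _ _).trans_lt hy).le⟩

/-- The diagonal intersection of clubs is a club. -/
theorem isClub_diagonal {t : Omega1 → Set Omega1} (ht : ∀ x, IsClub (t x)) :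
    IsClub {α | ∀ x < α, α ∈ t x} := by
  refine ⟨fun d hd hne _ a ha x hx => ?_, fun z => ?_⟩
  · -- the part of `d` above `x` lies in `t x` and has the same supremum
    obtain ⟨y, hy, hxy⟩ := (lt_isLUB_iff ha).1 hx
    refine (ht x).isLUB_mem (t := d ∩ Ici y) (fun w hw => hd hw.1 x (hxy.trans_le hw.2))
      ⟨y, hy, mem_Ici.2 le_rfl⟩ ⟨fun w hw => ha.1 hw.1, fun u hu => ha.2 fun w hw => ?_⟩
    rcases le_total y w with h | h
    · exact hu ⟨hw, h⟩
    · exact h.trans (hu ⟨hy, mem_Ici.2 le_rfl⟩)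
  · have step : ∀ x, ∃ y, x < y ∧ ∀ u ≤ x, y ∈ t u := fun x => by
      have := ((countable_Iio x).insert x).to_subtype
      have hc : IsClub (⋂ u : (insert x (Iio x) : Set Omega1), t u) :=
        IsClub.iInter_of_countable cof_Omega1_ne fun u => ht u
      obtain ⟨y, hy, hxy⟩ := exists_mem_gt hc.isCofinal x
      refine ⟨y, hxy, fun u hu => mem_iInter.1 hy ⟨u, ?_⟩⟩
      rcases hu.eq_or_lt with h | h
      · exact Or.inl h
      · exact Or.inr h
    choose f hf hft using step
    have hmono : StrictMono fun n : ℕ => f^[n] z := strictMono_nat_of_lt_succ fun n => by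
      rw [Function.iterate_succ_apply']
      exact hf _
    obtain ⟨c, hc⟩ := exists_gt_of_countable (countable_range fun n : ℕ => f^[n] z)
    have hex : (upperBounds (range fun n : ℕ => f^[n] z)).Nonempty :=
      ⟨c, fun a ha => (hc a ha).le⟩
    have hlub : IsLUB (range fun n : ℕ => f^[n] z) ((wellFounded_lt (α := Omega1)).min _ hex) :=
      ⟨WellFounded.min_mem _ _ hex, fun u hu => not_lt.1 ((wellFounded_lt (α := Omega1)).not_lt_min _ hu)⟩
    refine ⟨_, fun x hx => ?_, hlub.1 ⟨0, rfl⟩⟩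
    obtain ⟨_, ⟨n, rfl⟩, hn⟩ := (lt_isLUB_iff hlub).1 hx
    refine (ht x).isLUB_mem (t := range fun k : ℕ => f^[n + 1 + k] z) ?_ (range_nonempty _)
      ⟨?_, fun u hu => hlub.2 ?_⟩
    · rintro _ ⟨k, rfl⟩
      have : n + 1 + k = (n + k) + 1 := by ring
      simp only [this, Function.iterate_succ_apply']
      exact hft _ _ (hn.le.trans (hmono.monotone (Nat.le_add_right n k)))
    · rintro _ ⟨k, rfl⟩
      exact hlub.1 ⟨_, rfl⟩
    · rintro _ ⟨k, rfl⟩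
      exact (hmono.monotone (Nat.le_add_left k (n + 1))).trans (hu ⟨k, rfl⟩)

theorem isClub_closed (φ : Omega1 → Omega1) : IsClub {α | ∀ x < α, φ x < α} :=
  isClub_diagonal fun x => isClub_Ioi (φ x)

/-- The limit points of a cofinal set, together with `0`, form a club. -/
theorem isClub_limitPoints {t : Set Omega1} (ht : IsCofinal t) :
    IsClub {α | ∀ x < α, ∃ c ∈ t, x < c ∧ c < α} := by
  choose φ hφ hlt using exists_mem_gt ht
  have h : IsClub {α | ∀ x < α, φ x < α} := isClub_closed φ
  refine ⟨fun d hd hne _ a ha x hx => ?_, h.isCofinal.mono (fun α (hα : ∀ x < α, φ x < α) x hx =>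
    ⟨φ x, hφ x, hlt x, hα x hx⟩)⟩
  obtain ⟨y, hy, hxy⟩ := (lt_isLUB_iff ha).1 hx
  obtain ⟨c, hc, h1, h2⟩ := hd hy x hxy
  exact ⟨c, hc, h1, h2.trans_le (ha.1 hy)⟩

theorem _root_.IsStationary.inter_isClub {S t : Set Omega1} (hS : IsStationary S)
    (ht : IsClub t) : IsStationary (S ∩ t) := fun u hu => by
  rw [inter_assoc]
  exact hS (ht.inter cof_Omega1_ne hu)

theorem _root_.IsStationary.exists_gt {S : Set Omega1} (hS : IsStationary S) (x : Omega1) :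
    ∃ α ∈ S, x < α := hS (isClub_Ioi x)

/-- Fodor's pressing-down lemma. -/
theorem _root_.IsStationary.exists_fiber_of_regressive {S : Set Omega1} (hS : IsStationary S)
    {b : Omega1 → Omega1} (hb : ∀ α ∈ S, b α < α) :
    ∃ x, IsStationary {α ∈ S | b α = x} := by
  by_contra! h
  simp_rw [not_isStationary_iff] at h
  choose t ht hdisj using h
  obtain ⟨α, hα, hαt⟩ := hS (isClub_diagonal ht)
  exact (hdisj (b α)).le_bot ⟨⟨hα, rfl⟩, hαt _ (hb α hα)⟩

theorem _root_.IsStationary.exists_fiber_of_countable {ι : Type*} {S : Set Omega1}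
    (hS : IsStationary S) {f : Omega1 → ι} (hf : (f '' S).Countable) :
    ∃ i, IsStationary {α ∈ S | f α = i} := by
  have := hf.to_subtype
  have h : IsStationary (⋃ i : f '' S, {α ∈ S | f α = i}) :=
    hS.mono fun α hα => mem_iUnion.2 ⟨⟨f α, mem_image_of_mem f hα⟩, hα, rfl⟩
  obtain ⟨i, hi⟩ := (isStationary_iUnion_iff_of_countable cof_Omega1_ne).1 h
  exact ⟨i, hi⟩

theorem exists_lt_forall_le_of_finite {A : Set Omega1} {α x : Omega1} (hA : A.Finite) (hx : x < α)
    (h : ∀ y ∈ A, y < α) : ∃ b < α, x ≤ b ∧ ∀ y ∈ A, y ≤ b := by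
  obtain ⟨c, hc, hc'⟩ := Set.exists_max_image (insert x A) id (hA.insert x) ⟨x, Or.inl rfl⟩
  refine ⟨c, ?_, hc' x (Or.inl rfl), fun y hy => hc' y (Or.inr hy)⟩
  rcases hc with rfl | hc
  · exact hx
  · exact h c hc

namespace CSequence

variable (c : CSequence)

/-! ### Walks and their upper traces -/

theorem step_mem {α β : Omega1} (h : α < β) : c.step α β h ∈ c.C β :=
  (WellFounded.min_mem _ _ (c.diff_nonempty h)).1

theorem le_step {α β : Omega1} (h : α < β) : α ≤ c.step α β h :=
  not_lt.1 (WellFounded.min_mem _ _ (c.diff_nonempty h)).2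

theorem step_le {α β η : Omega1} (h : α < β) (hη : η ∈ c.C β) (hαη : α ≤ η) :
    c.step α β h ≤ η :=
  not_lt.1 ((wellFounded_lt (α := Omega1)).not_lt_min (c.C β \ Iio α) ⟨hη, not_lt.2 hαη⟩)

/-- Induction along the walk from `β` down to `α`. -/
theorem walk_induction {α : Omega1} {p : Omega1 → Prop} (self : p α)
    (step : ∀ β (h : α < β), p (c.step α β h) → p β) : ∀ β, α ≤ β → p β := by
  intro β
  induction β using (wellFounded_lt (α := Omega1)).induction with
  | _ β ih =>
    intro h
    rcases h.eq_or_lt with rfl | h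
    · exact self
    · exact step β h (ih _ (c.step_lt h) (c.le_step h))

theorem upperTrace_self (α : Omega1) : c.upperTrace α α = ∅ := by
  rw [upperTrace, dif_neg (lt_irrefl α)]

theorem upperTrace_of_lt {α β : Omega1} (h : α < β) :
    c.upperTrace α β = insert β (c.upperTrace α (c.step α β h)) := by
  rw [upperTrace, dif_pos h]

theorem lt_of_mem_upperTrace {α β : Omega1} (h : α ≤ β) :
    ∀ η ∈ c.upperTrace α β, α < η := by
  refine c.walk_induction (p := fun β => ∀ η ∈ c.upperTrace α β, α < η) ?_ ?_ β h
  · simp [upperTrace_self]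
  · intro β h ih η hη
    rw [c.upperTrace_of_lt h, Finset.mem_insert] at hη
    rcases hη with rfl | hη
    · exact h
    · exact ih η hη

theorem inter_Iio_eq {η ξ α : Omega1} (hξ : ξ ≤ α) (h : ∀ y ∈ c.C η, y < α → y < ξ) :
    c.C η ∩ Iio ξ = c.C η ∩ Iio α :=
  Set.ext fun y => ⟨fun hy => ⟨hy.1, lt_of_lt_of_le hy.2 hξ⟩, fun hy => ⟨hy.1, h y hy.1 hy.2⟩⟩

theorem step_eq {ξ α β : Omega1} (hξ : ξ ≤ α) (hα : α < β)
    (h : ∀ y ∈ c.C β, y < α → y < ξ) : c.step ξ β (hξ.trans_lt hα) = c.step α β hα := by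
  refine le_antisymm (c.step_le _ (c.step_mem hα) (hξ.trans (c.le_step hα)))
    (c.step_le _ (c.step_mem _) (not_lt.1 fun hlt => ?_))
  exact (h _ (c.step_mem _) hlt).not_ge (c.le_step _)

/-- If no ladder met on the walk from `β` to `α` has an element in `[ξ, α)`, then the walk from `β`
to `ξ` passes through `α`. -/
theorem upperTrace_eq_union {ξ α β : Omega1} (hξ : ξ < α) (hαβ : α ≤ β)
    (h : ∀ η ∈ c.upperTrace α β, ∀ y ∈ c.C η, y < α → y < ξ) :
    c.upperTrace ξ β = c.upperTrace α β ∪ c.upperTrace ξ α := by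
  revert h
  refine c.walk_induction (p := fun β => (∀ η ∈ c.upperTrace α β, ∀ y ∈ c.C η, y < α → y < ξ) →
    c.upperTrace ξ β = c.upperTrace α β ∪ c.upperTrace ξ α) ?_ ?_ β hαβ
  · simp [upperTrace_self]
  · intro β hα ih h
    rw [c.upperTrace_of_lt hα] at h ⊢
    rw [c.upperTrace_of_lt (hξ.trans hα),
      c.step_eq hξ.le hα (h β (Finset.mem_insert_self _ _)),
      ih fun η hη => h η (Finset.mem_insert_of_mem hη), Finset.insert_union]

theorem finite_ladder_below {α β : Omega1} (h : α ≤ β) :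
    {y | y < α ∧ ∃ η ∈ c.upperTrace α β, y ∈ c.C η}.Finite := by
  refine ((c.upperTrace α β).finite_toSet.biUnion fun η hη =>
    c.finite_inter (c.lt_of_mem_upperTrace h η hη)).subset ?_
  rintro y ⟨hy, η, hη, hyη⟩
  exact mem_biUnion hη ⟨hyη, hy⟩

/-! ### The maximum weight functions -/

theorem e_of_lt {α β : Omega1} (h : α < β) :
    c.e β α = max ((c.C β ∩ Iio α).ncard) (c.e (c.step α β h) α) := by
  rw [e, c.upperTrace_of_lt h, Finset.sup_insert]
  rfl

/-- The functions `e_β` are finite-to-one: the weight of the first step of the walk bounds the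
number of possible first steps. -/
theorem finite_e_le (β : Omega1) (n : ℕ) : {ξ | ξ < β ∧ c.e β ξ ≤ n}.Finite := by
  induction β using (wellFounded_lt (α := Omega1)).induction with
  | _ β ih =>
    have hfin : {s | s ∈ c.C β ∧ (c.C β ∩ Iio s).ncard ≤ n}.Finite := by
      refine Set.Finite.of_finite_image (f := fun s => (c.C β ∩ Iio s).ncard)
        ((finite_Iic n).subset ?_) ?_
      · rintro _ ⟨s, hs, rfl⟩
        exact hs.2
      · have key : ∀ s ∈ c.C β, ∀ t ∈ c.C β, s < t →
            (c.C β ∩ Iio s).ncard < (c.C β ∩ Iio t).ncard := fun s hs t ht hst =>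
          Set.ncard_lt_ncard ⟨fun y hy => ⟨hy.1, lt_trans hy.2 hst⟩,
            fun hsub => lt_irrefl s (hsub ⟨hs, hst⟩).2⟩ (c.finite_inter (c.subset_Iio β ht))
        intro s hs t ht hst
        rcases lt_trichotomy s t with h | h | h
        · exact absurd hst (key s hs.1 t ht.1 h).ne
        · exact h
        · exact absurd hst (key t ht.1 s hs.1 h).ne'
    refine (hfin.biUnion (t := fun s => insert s {ξ | ξ < s ∧ c.e s ξ ≤ n})
      fun s hs => (ih s (c.subset_Iio β hs.1)).insert s).subset ?_
    rintro ξ ⟨hξ, hle⟩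
    rw [c.e_of_lt hξ, max_le_iff] at hle
    refine mem_biUnion (x := c.step ξ β hξ) ⟨c.step_mem hξ, ?_⟩ ?_
    · rw [← c.inter_Iio_eq (c.le_step hξ) fun y hy hlt => not_le.1 fun h => ?_]
      · exact hle.1
      · exact (c.step_le hξ hy h).not_gt hlt
    · rcases (c.le_step hξ).eq_or_lt with h | h
      · exact Or.inl h
      · exact Or.inr ⟨h, hle.2⟩

theorem e_eq_max {ξ α β : Omega1} (hξ : ξ < α) (hαβ : α ≤ β)
    (h : ∀ η ∈ c.upperTrace α β, ∀ y ∈ c.C η, y < α → y < ξ) :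
    c.e β ξ = max (c.e β α) (c.e α ξ) := by
  rw [e, c.upperTrace_eq_union hξ hαβ h, Finset.sup_union]
  congr 1
  exact Finset.sup_congr rfl fun η hη => by rw [c.inter_Iio_eq hξ.le (h η hη)]

/-- Coherence: `e_β` and `e_α` agree on a tail of `α`. The tail is chosen above the ladders met on
the walk from `β` to `α`. -/
theorem exists_e_eq {α β x : Omega1} (hαβ : α ≤ β) (hx : x < α) :
    ∃ b < α, x ≤ b ∧ (∀ η ∈ c.upperTrace α β, ∀ y ∈ c.C η, y < α → y ≤ b) ∧
      ∀ ξ, b < ξ → ξ < α → c.e β ξ = c.e α ξ := by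
  obtain ⟨b, hb, hxb, hbA⟩ := exists_lt_forall_le_of_finite
    ((c.finite_ladder_below hαβ).union (c.finite_e_le α (c.e β α))) hx
    (by rintro y (hy | hy) <;> exact hy.1)
  have hlad : ∀ η ∈ c.upperTrace α β, ∀ y ∈ c.C η, y < α → y ≤ b :=
    fun η hη y hy hyα => hbA y (Or.inl ⟨hyα, η, hη, hy⟩)
  refine ⟨b, hb, hxb, hlad, fun ξ hbξ hξ => ?_⟩
  rw [c.e_eq_max hξ hαβ fun η hη y hy hyα => (hlad η hη y hy hyα).trans_lt hbξ]
  exact max_eq_right (not_le.1 fun hle => (hbA ξ (Or.inr ⟨hξ, hle⟩)).not_gt hbξ).le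

/-! ### Lower traces -/

theorem lowerTrace_self (α : Omega1) : c.lowerTrace α α = ∅ := by
  rw [lowerTrace, dif_neg (lt_irrefl α)]

theorem mem_cut {α β : Omega1} (h : α < β) {y : Omega1} :
    y ∈ c.cut α β h ↔ y ∈ c.C β ∧ y < α := by
  rw [cut, Set.Finite.mem_toFinset]
  rfl

theorem lowerTrace_of_isGreatest {α β m : Omega1} (h : α < β)
    (hm : IsGreatest (c.C β ∩ Iio α) m) :
    c.lowerTrace α β = (insert m (c.lowerTrace α (c.step α β h))).filter (fun ξ => m ≤ ξ) := by
  have hne : (c.cut α β h).Nonempty := ⟨m, (c.mem_cut h).2 hm.1⟩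
  have hmax : (c.cut α β h).max' hne = m :=
    le_antisymm (hm.2 ((c.mem_cut h).1 (Finset.max'_mem _ hne)))
      (Finset.le_max' _ _ ((c.mem_cut h).2 hm.1))
  rw [lowerTrace, dif_pos h, dif_pos hne]
  simp only [hmax]

theorem lowerTrace_of_inter_eq_empty {α β : Omega1} (h : α < β) (hm : c.C β ∩ Iio α = ∅) :
    c.lowerTrace α β = c.lowerTrace α (c.step α β h) := by
  have hne : ¬ (c.cut α β h).Nonempty := by
    rintro ⟨y, hy⟩
    exact (hm ▸ notMem_empty y) ((c.mem_cut h).1 hy)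
  conv_lhs => rw [lowerTrace]
  rw [dif_pos h, dif_neg hne]

theorem exists_isGreatest_ladder {α β x : Omega1} (h : α < β) (hx : x ∈ c.C β) (hxα : x < α) :
    ∃ m, IsGreatest (c.C β ∩ Iio α) m := by
  obtain ⟨m, hm, hmax⟩ := Set.exists_max_image _ id (c.finite_inter h) ⟨x, hx, hxα⟩
  exact ⟨m, hm, hmax⟩

theorem inter_eq_empty_or_exists_isGreatest {α β : Omega1} (h : α < β) :
    c.C β ∩ Iio α = ∅ ∨ ∃ m, IsGreatest (c.C β ∩ Iio α) m := by
  rcases (c.C β ∩ Iio α).eq_empty_or_nonempty with h0 | ⟨x, hx, hxα⟩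
  · exact Or.inl h0
  · exact Or.inr (c.exists_isGreatest_ladder h hx hxα)

theorem isLeast_lowerTrace {α β m : Omega1} (h : α < β) (hm : IsGreatest (c.C β ∩ Iio α) m) :
    IsLeast (c.lowerTrace α β : Set Omega1) m := by
  rw [c.lowerTrace_of_isGreatest h hm]
  exact ⟨by simp, fun z hz => (Finset.mem_filter.1 hz).2⟩

theorem exists_ladder_of_mem_lowerTrace {α β : Omega1} (h : α ≤ β) :
    ∀ z ∈ c.lowerTrace α β, z < α ∧ ∃ η ∈ c.upperTrace α β, z ∈ c.C η := by
  refine c.walk_induction (p := fun β => ∀ z ∈ c.lowerTrace α β,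
    z < α ∧ ∃ η ∈ c.upperTrace α β, z ∈ c.C η) ?_ ?_ β h
  · simp [lowerTrace_self]
  · intro β h ih z hz
    rw [c.upperTrace_of_lt h]
    have hrec : z ∈ c.lowerTrace α (c.step α β h) →
        z < α ∧ ∃ η ∈ insert β (c.upperTrace α (c.step α β h)), z ∈ c.C η := fun hz => by
      obtain ⟨h1, η, hη, h2⟩ := ih z hz
      exact ⟨h1, η, Finset.mem_insert_of_mem hη, h2⟩
    rcases c.inter_eq_empty_or_exists_isGreatest h with h0 | ⟨m, hm⟩
    · exact hrec (c.lowerTrace_of_inter_eq_empty h h0 ▸ hz)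
    · rw [c.lowerTrace_of_isGreatest h hm, Finset.mem_filter, Finset.mem_insert] at hz
      rcases hz.1 with rfl | hz
      · exact ⟨hm.1.2, β, Finset.mem_insert_self _ _, hm.1.1⟩
      · exact hrec hz

theorem lowerTrace_eq_union {ξ α β : Omega1} (hξ : ξ < α) (hαβ : α ≤ β)
    (h : ∀ η ∈ c.upperTrace α β, ∀ y ∈ c.C η, y < α → y < ξ)
    (hL : ∀ η ∈ c.upperTrace α β, ∀ y ∈ c.C η, y < α → ∀ z ∈ c.lowerTrace ξ α, y ≤ z) :
    c.lowerTrace ξ β = c.lowerTrace α β ∪ c.lowerTrace ξ α := by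
  revert h hL
  refine c.walk_induction (p := fun β => (∀ η ∈ c.upperTrace α β, ∀ y ∈ c.C η, y < α → y < ξ) →
    (∀ η ∈ c.upperTrace α β, ∀ y ∈ c.C η, y < α → ∀ z ∈ c.lowerTrace ξ α, y ≤ z) →
    c.lowerTrace ξ β = c.lowerTrace α β ∪ c.lowerTrace ξ α) ?_ ?_ β hαβ
  · simp [lowerTrace_self]
  · intro β hα ih h hL
    rw [c.upperTrace_of_lt hα] at h hL
    have hβ := Finset.mem_insert_self β (c.upperTrace α (c.step α β hα))
    have hinter := c.inter_Iio_eq hξ.le (h β hβ)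
    have hs := c.step_eq hξ.le hα (h β hβ)
    have ih' := ih (fun η hη => h η (Finset.mem_insert_of_mem hη))
      (fun η hη => hL η (Finset.mem_insert_of_mem hη))
    rcases c.inter_eq_empty_or_exists_isGreatest hα with h0 | ⟨m, hm⟩
    · rw [c.lowerTrace_of_inter_eq_empty hα h0,
        c.lowerTrace_of_inter_eq_empty (hξ.trans hα) (hinter.trans h0), hs, ih']
    · rw [c.lowerTrace_of_isGreatest hα hm,
        c.lowerTrace_of_isGreatest (hξ.trans hα) (hinter ▸ hm), hs, ih',
        ← Finset.insert_union, Finset.filter_union,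
        Finset.filter_true_of_mem (s := c.lowerTrace ξ α)
          fun z hz => hL β hβ m hm.1.1 hm.1.2 z hz]

theorem exists_mem_ladder_gt {α x : Omega1} (hα : ∀ x < α, ∃ y, x < y ∧ y < α) (hx : x < α) :
    ∃ y ∈ c.C α, x < y := by
  obtain ⟨z, hxz, hz⟩ := hα x hx
  obtain ⟨y, hy, hzy⟩ := c.cofinal α z hz
  exact ⟨y, hy, hxz.trans_le hzy⟩

/-- The ordinal `b`, an element of the ladder on `α`, splits the walk from `β ≥ α` at `α`: on
`[b, α)` the functions `e_β` and `e_α` agree, and for `ξ` in `(b, α)` the lower trace `L(ξ, β)` is the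
concatenation of `L(α, β)`, which lies below `b`, and of `L(ξ, α)`, which does not. -/
structure Splits (b α β : Omega1) : Prop where
  mem_ladder : b ∈ c.C α
  lt : ∀ z ∈ c.lowerTrace α β, z < b
  e_eq : ∀ z, b ≤ z → z < α → c.e β z = c.e α z
  lowerTrace_eq : ∀ ξ, b < ξ → ξ < α → c.lowerTrace ξ β = c.lowerTrace α β ∪ c.lowerTrace ξ α
  le : ∀ ξ, b < ξ → ξ < α → ∀ z ∈ c.lowerTrace ξ α, b ≤ z

theorem exists_splits {α β x : Omega1} (hα : ∀ x < α, ∃ y, x < y ∧ y < α) (hαβ : α ≤ β)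
    (hx : x < α) : ∃ b, x ≤ b ∧ c.Splits b α β := by
  obtain ⟨b₀, hb₀, hxb, hlad, he⟩ := c.exists_e_eq hαβ hx
  -- `b` is taken in `C α`, to have `b ≤ max (C α ∩ ξ) = min L(ξ, α)` whenever `b < ξ < α`
  obtain ⟨b, hb, hlt⟩ := c.exists_mem_ladder_gt hα hb₀
  have hle : ∀ ξ, b < ξ → ξ < α → ∀ z ∈ c.lowerTrace ξ α, b ≤ z := fun ξ hbξ hξ z hz => by
    obtain ⟨m, hm⟩ := c.exists_isGreatest_ladder hξ hb hbξ
    exact (hm.2 ⟨hb, hbξ⟩).trans ((c.isLeast_lowerTrace hξ hm).2 hz)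
  refine ⟨b, hxb.trans hlt.le, hb, fun z hz => ?_, fun z hz => he z (hlt.trans_le hz),
    fun ξ hbξ hξ => ?_, hle⟩
  · obtain ⟨h1, η, hη, h2⟩ := c.exists_ladder_of_mem_lowerTrace hαβ z hz
    exact (hlad η hη z h2 h1).trans_lt hlt
  · exact c.lowerTrace_eq_union hξ hαβ
      (fun η hη y hy hyα => (hlad η hη y hy hyα).trans_lt (hlt.trans hbξ))
      fun η hη y hy hyα z hz => (hlad η hη y hy hyα).trans (hlt.le.trans (hle ξ hbξ hξ z hz))

end CSequence

/-! ### Counting alternations -/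

open Classical in
/-- The number of `ζ ∈ L`, other than the minimum, at which `p` fails although it holds at the
immediate predecessor of `ζ` in `L`. -/
noncomputable def alternations (L : Finset Omega1) (p : Omega1 → Prop) : ℕ :=
  (L.filter fun ζ => ∃ ξ, CSequence.IsPred L ξ ζ ∧ p ξ ∧ ¬ p ζ).card

theorem CSequence.osc_eq_alternations (c : CSequence) (α β : Omega1) :
    c.osc α β = alternations (c.lowerTrace α β) fun z => c.e α z ≤ c.e β z := by
  unfold osc alternations
  congr 1
  ext ζ
  simp only [Finset.mem_filter, not_le]

theorem alternations_congr {L : Finset Omega1} {p q : Omega1 → Prop} (h : ∀ z ∈ L, p z ↔ q z) :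
    alternations L p = alternations L q := by
  classical
  unfold alternations
  congr 1
  refine Finset.filter_congr fun ζ hζ => exists_congr fun ξ => and_congr_right fun hp => ?_
  rw [h ξ hp.1, h ζ hζ]

theorem alternations_eq_zero_of_forall {L : Finset Omega1} {p : Omega1 → Prop}
    (h : ∀ z ∈ L, p z) : alternations L p = 0 := by
  classical
  refine Finset.card_eq_zero.2 (Finset.filter_eq_empty_iff.2 ?_)
  rintro ζ hζ ⟨ξ, -, -, hn⟩
  exact hn (h ζ hζ)

theorem alternations_eq_zero_of_forall_not {L : Finset Omega1} {p : Omega1 → Prop}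
    (h : ∀ z ∈ L, ¬ p z) : alternations L p = 0 := by
  classical
  refine Finset.card_eq_zero.2 (Finset.filter_eq_empty_iff.2 ?_)
  rintro ζ - ⟨ξ, hp, hpξ, -⟩
  exact h ξ hp.1 hpξ

open Classical in
/-- Alternations of a concatenation: those of the two parts, and possibly one at the junction. -/
theorem alternations_union {A B : Finset Omega1} {p : Omega1 → Prop} {x y : Omega1}
    (hAB : ∀ a ∈ A, ∀ b ∈ B, a < b) (hx : IsGreatest (A : Set Omega1) x)
    (hy : IsLeast (B : Set Omega1) y) :
    alternations (A ∪ B) p =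
      alternations A p + alternations B p + if p x ∧ ¬ p y then 1 else 0 := by
  have hxA : x ∈ A := hx.1
  have hyB : y ∈ B := hy.1
  have hxmax : ∀ a ∈ A, a ≤ x := fun a ha => hx.2 ha
  have hymin : ∀ b ∈ B, y ≤ b := fun b hb => hy.2 hb
  have hA : ∀ ζ ∈ A, ∀ ξ, CSequence.IsPred (A ∪ B) ξ ζ ↔ CSequence.IsPred A ξ ζ := by
    intro ζ hζ ξ
    refine ⟨fun ⟨h1, h2, h3⟩ => ⟨?_, h2, fun η hη => h3 η (Finset.mem_union_left _ hη)⟩,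
      fun ⟨h1, h2, h3⟩ => ⟨Finset.mem_union_left _ h1, h2, fun η hη hlt => ?_⟩⟩
    · exact (Finset.mem_union.1 h1).resolve_right fun h => (hAB ζ hζ ξ h).not_gt h2
    · exact (Finset.mem_union.1 hη).elim (fun h => h3 η h hlt)
        fun h => absurd hlt (hAB ζ hζ η h).not_gt
  have hB : ∀ ζ ∈ B, ∀ ξ, CSequence.IsPred (A ∪ B) ξ ζ ↔
      CSequence.IsPred B ξ ζ ∨ ζ = y ∧ ξ = x := by
    intro ζ hζ ξ
    constructor
    · rintro ⟨h1, h2, h3⟩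
      rcases Finset.mem_union.1 h1 with h1 | h1
      · -- a predecessor in `A` lies below `y`, hence is that of `y`
        have hζy : ζ = y := by
          refine le_antisymm (not_lt.1 fun h => ?_) (hymin ζ hζ)
          exact (h3 y (Finset.mem_union_right _ hyB) h).not_gt (hAB ξ h1 y hyB)
        exact Or.inr ⟨hζy, le_antisymm (hxmax ξ h1)
          (h3 x (Finset.mem_union_left _ hxA) (hAB x hxA ζ hζ))⟩
      · exact Or.inl ⟨h1, h2, fun η hη => h3 η (Finset.mem_union_right _ hη)⟩
    · rintro (⟨h1, h2, h3⟩ | ⟨rfl, rfl⟩)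
      · refine ⟨Finset.mem_union_right _ h1, h2, fun η hη hlt => ?_⟩
        exact (Finset.mem_union.1 hη).elim (fun h => (hAB η h ξ h1).le) fun h => h3 η h hlt
      · refine ⟨Finset.mem_union_left _ hxA, hAB _ hxA _ hyB, fun η hη hlt => ?_⟩
        exact (Finset.mem_union.1 hη).elim (hxmax η) fun h => absurd hlt (hymin η h).not_gt
  have hyno : ∀ ξ, ¬ CSequence.IsPred B ξ y := fun ξ h => (hymin ξ h.1).not_gt h.2.1
  have hset : ((A ∪ B).filter fun ζ => ∃ ξ, CSequence.IsPred (A ∪ B) ξ ζ ∧ p ξ ∧ ¬ p ζ) =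
      (A.filter fun ζ => ∃ ξ, CSequence.IsPred A ξ ζ ∧ p ξ ∧ ¬ p ζ) ∪
      ((B.filter fun ζ => ∃ ξ, CSequence.IsPred B ξ ζ ∧ p ξ ∧ ¬ p ζ) ∪
        if p x ∧ ¬ p y then {y} else ∅) := by
    rw [Finset.filter_union]
    congr 1
    · exact Finset.filter_congr fun ζ hζ => by simp only [hA ζ hζ]
    · ext ζ
      simp only [Finset.mem_union, Finset.mem_filter]
      constructor
      · rintro ⟨hζ, ξ, hp, h1, h2⟩
        rcases (hB ζ hζ ξ).1 hp with hp | ⟨rfl, rfl⟩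
        · exact Or.inl ⟨hζ, ξ, hp, h1, h2⟩
        · right
          rw [if_pos ⟨h1, h2⟩]
          exact Finset.mem_singleton_self _
      · rintro (⟨hζ, ξ, hp, h⟩ | h)
        · exact ⟨hζ, ξ, (hB ζ hζ ξ).2 (Or.inl hp), h⟩
        · split_ifs at h with hxy
          · rw [Finset.mem_singleton] at h
            subst h
            exact ⟨hyB, x, (hB _ hyB x).2 (Or.inr ⟨rfl, rfl⟩), hxy⟩
          · exact absurd h (Finset.notMem_empty _)
  have hdisj : Disjoint A B := Finset.disjoint_left.2 fun z h1 h2 => lt_irrefl z (hAB z h1 z h2)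
  have hdisj' : Disjoint (B.filter fun ζ => ∃ ξ, CSequence.IsPred B ξ ζ ∧ p ξ ∧ ¬ p ζ)
      (if p x ∧ ¬ p y then {y} else ∅) := by
    split_ifs
    · rw [Finset.disjoint_singleton_right, Finset.mem_filter]
      rintro ⟨-, ξ, h, -⟩
      exact hyno ξ h
    · exact Finset.disjoint_empty_right _
  have hsub : (B.filter fun ζ => ∃ ξ, CSequence.IsPred B ξ ζ ∧ p ξ ∧ ¬ p ζ) ∪
      (if p x ∧ ¬ p y then {y} else ∅) ⊆ B := by
    refine Finset.union_subset (Finset.filter_subset _ _) ?_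
    split_ifs
    · exact Finset.singleton_subset_iff.2 hyB
    · exact Finset.empty_subset _
  unfold alternations
  rw [hset, Finset.card_union_of_disjoint (hdisj.mono (Finset.filter_subset _ _) hsub),
    Finset.card_union_of_disjoint hdisj', ← add_assoc]
  congr 1
  split_ifs <;> rfl

namespace CSequence

variable (c : CSequence)

/-! ### Prescribing values of the functions `e_ξ` -/

/-- In every uncountable set of ordinals `a` one can make `e_a` large on any finite set above a fixed
ordinal. Otherwise a single `e_a` would be bounded on infinitely many points. -/
theorem exists_forall_e_gt {Ξ : Set Omega1} (hΞ : IsCofinal Ξ) :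
    ∃ x, ∀ G : Finset Omega1, (∀ g ∈ G, x ≤ g) → ∀ N : ℕ, ∀ η, ∃ a ∈ Ξ, η < a ∧
      ∀ g ∈ G, N < c.e a g := by
  by_contra! hcon
  choose G hG N η hbad using hcon
  obtain ⟨n, hn⟩ := (IsStationary.exists_fiber_of_countable
    .univ (f := N) (to_countable _))
  have key : ∀ x, ∃ u, η x ≤ u ∧ (∀ g ∈ G x, g < u) ∧ ∃ y, x < y ∧ y < u ∧ N y = n := fun x => by
    obtain ⟨y, hy, hxy⟩ := hn.exists_gt x
    obtain ⟨u, hu⟩ := exists_gt_of_countable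
      (((G x).finite_toSet.countable.insert (η x)).insert y)
    exact ⟨u, (hu _ (Or.inr (Or.inl rfl))).le, fun g hg => hu g (Or.inr (Or.inr hg)), y, hxy,
      hu y (Or.inl rfl), hy.2⟩
  choose φ hη hGφ hnext using key
  obtain ⟨x₀⟩ : Nonempty Omega1 := inferInstance
  obtain ⟨δ, hδ, hx₀⟩ := exists_mem_gt (isClub_closed φ).isCofinal x₀
  obtain ⟨a, ha, hδa⟩ := hΞ δ
  -- every `x < δ` with `N x = n` gives a point of `[x, δ)` at which `e_a` is at most `n`
  obtain ⟨b, hb, -, hbA⟩ := exists_lt_forall_le_of_finite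
    ((c.finite_e_le a n).inter_of_left (Iio δ)) hx₀ fun y hy => hy.2
  obtain ⟨x, hbx, hxu, hxn⟩ := hnext b
  have hxδ : x < δ := hxu.trans (hδ b hb)
  obtain ⟨g, hg, hle⟩ := hbad x a ha (((hη x).trans_lt (hδ x hxδ)).trans_le hδa)
  have hgδ : g < δ := (hGφ x g hg).trans (hδ x hxδ)
  exact (hbA g ⟨⟨hgδ.trans_le hδa, hxn ▸ hle⟩, hgδ⟩).not_gt (hbx.trans_le (hG x g hg))

/-- A club of ordinals `δ` below which all restrictions `e_a|H`, with `a ≥ δ` and `H ⊆ δ` finite,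
are reflected cofinally often. -/
theorem exists_isClub_reflecting : ∃ E : Set Omega1, IsClub E ∧
    ∀ δ ∈ E, ∀ H : Finset Omega1, (∀ x ∈ H, x < δ) → ∀ a, δ ≤ a → ∀ m < δ,
      ∃ ξ, m < ξ ∧ ξ < δ ∧ ∀ x ∈ H, c.e ξ x = c.e a x := by
  classical
  have key : ∀ y : Omega1, ∃ u, ∀ P : Finset (Iic y × ℕ),
      (∃ ξ, y < ξ ∧ ∀ q ∈ P, c.e ξ q.1 = q.2) → ∃ ξ, y < ξ ∧ ξ < u ∧ ∀ q ∈ P, c.e ξ q.1 = q.2 := by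
    intro y
    have hcnt : Countable (Iic y) := by
      rw [← Iio_insert]
      exact ((countable_Iio y).insert y).to_subtype
    have hw : ∀ P : Finset (Iic y × ℕ), ∃ ξ₀, (∃ ξ, y < ξ ∧ ∀ q ∈ P, c.e ξ q.1 = q.2) →
        y < ξ₀ ∧ ∀ q ∈ P, c.e ξ₀ q.1 = q.2 := fun P => by
      by_cases h : ∃ ξ, y < ξ ∧ ∀ q ∈ P, c.e ξ q.1 = q.2
      · exact ⟨h.choose, fun _ => h.choose_spec⟩
      · exact ⟨y, fun h' => absurd h' h⟩
    choose w hw using hw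
    obtain ⟨u, hu⟩ := exists_gt_of_countable (countable_range w)
    exact ⟨u, fun P h => ⟨w P, (hw P h).1, hu _ ⟨P, rfl⟩, (hw P h).2⟩⟩
  choose φ hφ using key
  refine ⟨{δ | ∀ x < δ, φ x < δ}, isClub_closed φ, fun δ hδ H hH a ha m hm => ?_⟩
  obtain ⟨y, hy, hmy, hHy⟩ := exists_lt_forall_le_of_finite H.finite_toSet hm hH
  let P : Finset (Iic y × ℕ) := H.attach.image fun x => (⟨x.1, hHy x.1 x.2⟩, c.e a x.1)
  obtain ⟨ξ, hyξ, hξ, hP⟩ := hφ y P ⟨a, hy.trans_le ha, fun q hq => by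
    obtain ⟨x, -, rfl⟩ := Finset.mem_image.1 hq
    exact Eq.refl (c.e a x.1)⟩
  exact ⟨ξ, hmy.trans_lt hyξ, hξ.trans (hδ y hy), fun x hx =>
    hP (⟨x, hHy x hx⟩, c.e a x)
      (Finset.mem_image.2 ⟨⟨x, hx⟩, Finset.mem_attach _ _, Eq.refl _⟩)⟩

/-- A club of ordinals `α` such that, for `g < α ≤ a₀`, the value of `e_a` at almost every `m < α`
can be made large without changing the value `e_{a₀}(g)` at `g`. -/
theorem exists_isClub_unbounded : ∃ K : Set Omega1, IsClub K ∧
    ∀ α ∈ K, ∀ g < α, ∀ a₀, α ≤ a₀ → ∃ x < α, ∀ m, x ≤ m → ∀ N : ℕ,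
      ∃ a, α < a ∧ c.e a g = c.e a₀ g ∧ N < c.e a m := by
  have key : ∀ g, ∃ u, ∀ v : ℕ, (∃ a₀, u ≤ a₀ ∧ c.e a₀ g = v) → ∃ x < u, ∀ m, x ≤ m →
      ∀ N : ℕ, ∀ η, ∃ a, η < a ∧ c.e a g = v ∧ N < c.e a m := by
    intro g
    have hw : ∀ v : ℕ, ∃ x, (∃ a₀, x < a₀ ∧ c.e a₀ g = v) → ∀ m, x ≤ m →
        ∀ N : ℕ, ∀ η, ∃ a, η < a ∧ c.e a g = v ∧ N < c.e a m := fun v => by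
      by_cases h : IsCofinal {a | c.e a g = v}
      · obtain ⟨x, hx⟩ := c.exists_forall_e_gt h
        refine ⟨x, fun _ m hm N η => ?_⟩
        obtain ⟨a, ha, hηa, hN⟩ := hx {m} (fun g hg => Finset.mem_singleton.1 hg ▸ hm) N η
        exact ⟨a, hηa, ha, hN m (Finset.mem_singleton_self m)⟩
      · obtain ⟨x, hx⟩ := not_isCofinal_iff.1 h
        exact ⟨x, fun ⟨a₀, h1, h2⟩ => absurd h1 (hx a₀ h2).not_gt⟩
    choose w hw using hw
    obtain ⟨u, hu⟩ := exists_gt_of_countable (countable_range w)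
    exact ⟨u, fun v ⟨a₀, h1, h2⟩ => ⟨w v, hu _ ⟨v, rfl⟩,
      hw v ⟨a₀, (hu _ ⟨v, rfl⟩).trans_le h1, h2⟩⟩⟩
  choose φ hφ using key
  refine ⟨{α | ∀ x < α, φ x < α}, isClub_closed φ, fun α hα g hg a₀ ha₀ => ?_⟩
  obtain ⟨x, hx, h⟩ := hφ g _ ⟨a₀, (hα g hg).le.trans ha₀, rfl⟩
  exact ⟨x, hx.trans (hα g hg), fun m hm N => h m hm N α⟩

end CSequence

namespace CSequence

variable {c : CSequence}

/-! ### Oscillations along a split walk -/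

theorem Splits.alternations_lowerTrace {b ξ α β : Omega1} (h : c.Splits b α β) (hb : b < ξ)
    (hξ : ξ < α) :
    alternations (c.lowerTrace ξ α) (fun z => c.e ξ z ≤ c.e β z) = c.osc ξ α := by
  rw [c.osc_eq_alternations]
  refine alternations_congr fun z hz => ?_
  rw [h.e_eq z (h.le ξ hb hξ z hz) ((c.exists_ladder_of_mem_lowerTrace hξ.le z hz).1.trans hξ)]

theorem Splits.osc_eq {b ξ α β : Omega1} (h : c.Splits b α β) (hb : b < ξ) (hξ : ξ < α)
    (h0 : c.lowerTrace α β = ∅) : c.osc ξ β = c.osc ξ α := by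
  rw [c.osc_eq_alternations ξ β, h.lowerTrace_eq ξ hb hξ, h0, Finset.empty_union,
    h.alternations_lowerTrace hb hξ]

open Classical in
theorem Splits.osc_eq_add {b ξ α β x y : Omega1} (h : c.Splits b α β) (hb : b < ξ) (hξ : ξ < α)
    (hx : IsGreatest (c.lowerTrace α β : Set Omega1) x)
    (hy : IsLeast (c.lowerTrace ξ α : Set Omega1) y) :
    c.osc ξ β = alternations (c.lowerTrace α β) (fun z => c.e ξ z ≤ c.e β z) + c.osc ξ α +
      if c.e ξ x ≤ c.e β x ∧ c.e α y < c.e ξ y then 1 else 0 := by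
  rw [c.osc_eq_alternations ξ β, h.lowerTrace_eq ξ hb hξ,
    alternations_union (fun z hz w hw => (h.lt z hz).trans_le (h.le ξ hb hξ w hw)) hx hy,
    h.alternations_lowerTrace hb hξ]
  have hey : c.e β y = c.e α y := h.e_eq y (h.le ξ hb hξ y hy.1)
    ((c.exists_ladder_of_mem_lowerTrace hξ.le y hy.1).1.trans hξ)
  simp only [not_le, hey]

theorem Splits.exists_isLeast {b α β ξ : Omega1} (h : c.Splits b α β) (hb : b < ξ) (hξ : ξ < α) :
    ∃ y, b ≤ y ∧ IsLeast (c.lowerTrace ξ α : Set Omega1) y := by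
  obtain ⟨m, hm⟩ := c.exists_isGreatest_ladder hξ h.mem_ladder hb
  exact ⟨m, hm.2 ⟨h.mem_ladder, hb⟩, c.isLeast_lowerTrace hξ hm⟩

variable (c) in
/-- If the club `E` accumulates to `α`, then the ladder on `α` has gaps, arbitrarily high in `α`,
that contain an element `δ` of `E`; below `δ` the minimum of `L(ξ, α)` is the start of the gap. -/
theorem exists_ladder_gap {E : Set Omega1} {α x : Omega1}
    (hE : ∀ x < α, ∃ δ ∈ E, x < δ ∧ δ < α) (hx : x < α) :
    ∃ δ ∈ E, δ < α ∧ ∃ m, x < m ∧ m < δ ∧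
      ∀ ξ, m < ξ → ξ < δ → IsLeast (c.lowerTrace ξ α : Set Omega1) m := by
  obtain ⟨y, hy, hxy⟩ := c.exists_mem_ladder_gt
    (fun x hx => (hE x hx).imp fun δ hδ => hδ.2) hx
  obtain ⟨δ, hδE, hyδ, hδ⟩ := hE y (c.subset_Iio α hy)
  obtain ⟨m, hm⟩ := c.exists_isGreatest_ladder hδ hy hyδ
  refine ⟨δ, hδE, hδ, m, hxy.trans_le (hm.2 ⟨hy, hyδ⟩), hm.1.2, fun ξ hmξ hξδ => ?_⟩
  exact c.isLeast_lowerTrace (hξδ.trans hδ)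
    ⟨⟨hm.1.1, hmξ⟩, fun z hz => hm.2 ⟨hz.1, lt_trans hz.2 hξδ⟩⟩

theorem exists_isGreatest_coe {L : Finset Omega1} (h : L.Nonempty) :
    ∃ x, IsGreatest (L : Set Omega1) x := ⟨L.max' h, L.isGreatest_max' h⟩

/-- When `L(α, β)` and `L(γ, β')` are empty, a new oscillation is produced at the junction of
`L(α, γ)` and `L(ξ, α)`. -/
theorem exists_osc_ne_of_empty {E K : Set Omega1} {b α β γ β' : Omega1}
    (hE : ∀ δ ∈ E, ∀ H : Finset Omega1, (∀ x ∈ H, x < δ) → ∀ a, δ ≤ a → ∀ m < δ,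
      ∃ ξ, m < ξ ∧ ξ < δ ∧ ∀ x ∈ H, c.e ξ x = c.e a x)
    (hK : ∀ α ∈ K, ∀ g < α, ∀ a₀, α ≤ a₀ → ∃ x < α, ∀ m, x ≤ m → ∀ N : ℕ,
      ∃ a, α < a ∧ c.e a g = c.e a₀ g ∧ N < c.e a m)
    (hαE : ∀ x < α, ∃ δ ∈ E, x < δ ∧ δ < α) (hαK : α ∈ K) (hαγ : α < γ)
    (hα : c.Splits b α β) (hγ : c.Splits b γ β')
    (hα0 : c.lowerTrace α β = ∅) (hγ0 : c.lowerTrace γ β' = ∅) :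
    ∃ ξ < α, c.osc ξ β ≠ c.osc ξ β' := by
  have hbα : b < α := c.subset_Iio α hα.mem_ladder
  obtain ⟨b₁, hb₁, hs⟩ := c.exists_splits (fun x hx => (hαE x hx).imp fun δ hδ => hδ.2)
    hαγ.le hbα
  have hb₁α : b₁ < α := c.subset_Iio α hs.mem_ladder
  obtain ⟨y, -, hy⟩ := hγ.exists_isLeast hbα hαγ
  obtain ⟨g, hg⟩ := exists_isGreatest_coe ⟨y, hy.1⟩
  have hgb : g < b₁ := hs.lt g hg.1
  obtain ⟨x, hx, hxK⟩ := hK α hαK g (hgb.trans hb₁α) γ hαγ.le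
  obtain ⟨δ, hδE, hδ, m, hxm, hmδ, hm⟩ := c.exists_ladder_gap hαE (max_lt hx hb₁α)
  have hb₁m : b₁ < m := (le_max_right _ _).trans_lt hxm
  obtain ⟨a, ha, hag, ham⟩ := hxK m ((le_max_left _ _).trans hxm.le) (c.e α m)
  obtain ⟨ξ, hmξ, hξδ, hξ⟩ := hE δ hδE {g, m}
    (by
      intro z hz
      rcases Finset.mem_insert.1 hz with rfl | hz
      · exact hgb.trans (hb₁m.trans hmδ)
      · exact Finset.mem_singleton.1 hz ▸ hmδ) a (hδ.trans ha).le m hmδ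
  have hξg : c.e ξ g = c.e γ g := (hξ g (Finset.mem_insert_self _ _)).trans hag
  have hξm : c.e α m < c.e ξ m :=
    (hξ m (Finset.mem_insert_of_mem (Finset.mem_singleton_self m))).symm ▸ ham
  have hξα : ξ < α := hξδ.trans hδ
  have hb₁ξ : b₁ < ξ := hb₁m.trans hmξ
  refine ⟨ξ, hξα, ?_⟩
  rw [hα.osc_eq (hb₁.trans_lt hb₁ξ) hξα hα0,
    hγ.osc_eq (hb₁.trans_lt hb₁ξ) (hξα.trans hαγ) hγ0,
    hs.osc_eq_add hb₁ξ hξα hg (hm ξ hmξ hξδ), if_pos ⟨hξg.le, hξm⟩]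
  omega

/-- When `L(α, β) = L(γ, β')` is not empty, `e_ξ` is prescribed to exceed `e_γ` on the whole of
`L(α, γ)` and to agree with the common values of `e_β` and `e_β'` below and with `e_α` above. This
produces exactly one new oscillation, at the minimum of `L(α, γ)`. -/
theorem exists_osc_ne_of_nonempty {E : Set Omega1} {b α β γ β' : Omega1}
    (hE : ∀ δ ∈ E, ∀ H : Finset Omega1, (∀ x ∈ H, x < δ) → ∀ a, δ ≤ a → ∀ m < δ,
      ∃ ξ, m < ξ ∧ ξ < δ ∧ ∀ x ∈ H, c.e ξ x = c.e a x)
    (hαE : ∀ x < α, ∃ δ ∈ E, x < δ ∧ δ < α) (hαγ : α < γ)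
    (hα : c.Splits b α β) (hγ : c.Splits b γ β')
    (hF : c.lowerTrace γ β' = c.lowerTrace α β) (hne : (c.lowerTrace α β).Nonempty)
    (he : ∀ z ∈ c.lowerTrace α β, c.e β' z = c.e β z)
    (hΞ : ∀ G : Finset Omega1, (∀ g ∈ G, b ≤ g) → ∀ N : ℕ, ∀ η,
      ∃ a, (∀ z ∈ c.lowerTrace α β, c.e a z = c.e β z) ∧ η < a ∧ ∀ g ∈ G, N < c.e a g) :
    ∃ ξ < α, c.osc ξ β ≠ c.osc ξ β' := by
  have hlim : ∀ x < α, ∃ y, x < y ∧ y < α := fun x hx => (hαE x hx).imp fun δ hδ => hδ.2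
  have hbα : b < α := c.subset_Iio α hα.mem_ladder
  obtain ⟨b₁, hb₁, hs⟩ := c.exists_splits hlim hαγ.le hbα
  have hb₁α : b₁ < α := c.subset_Iio α hs.mem_ladder
  obtain ⟨y, hby, hy⟩ := hγ.exists_isLeast hbα hαγ
  obtain ⟨g, hg⟩ := exists_isGreatest_coe ⟨y, hy.1⟩
  obtain ⟨x, hx⟩ := exists_isGreatest_coe hne
  obtain ⟨a, haF, ha, haG⟩ := hΞ (c.lowerTrace α γ) (fun z hz => hby.trans (hy.2 hz))
    ((c.lowerTrace α γ).sup (c.e γ)) α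
  obtain ⟨b₂, hb₂, -, -, hae⟩ := c.exists_e_eq ha.le hbα
  obtain ⟨δ, hδE, hδ, m, hxm, hmδ, hm⟩ := c.exists_ladder_gap hαE (max_lt hb₁α hb₂)
  have hb₁m : b₁ < m := (le_max_left _ _).trans_lt hxm
  have hb₂m : b₂ < m := (le_max_right _ _).trans_lt hxm
  obtain ⟨ξ, hmξ, hξδ, hξ⟩ := hE δ hδE (insert m (c.lowerTrace α β ∪ c.lowerTrace α γ))
    (by
      intro z hz
      rcases Finset.mem_insert.1 hz with rfl | hz
      · exact hmδ
      · rcases Finset.mem_union.1 hz with hz | hz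
        · exact (hα.lt z hz).trans (hb₁.trans_lt (hb₁m.trans hmδ))
        · exact (hs.lt z hz).trans (hb₁m.trans hmδ)) a (hδ.trans ha).le m hmδ
  have hξα : ξ < α := hξδ.trans hδ
  have hb₁ξ : b₁ < ξ := hb₁m.trans hmξ
  have hbξ : b < ξ := hb₁.trans_lt hb₁ξ
  have hξF : ∀ z ∈ c.lowerTrace α β, c.e ξ z = c.e β z := fun z hz =>
    (hξ z (Finset.mem_insert_of_mem (Finset.mem_union_left _ hz))).trans (haF z hz)
  have hξG : ∀ z ∈ c.lowerTrace α γ, c.e γ z < c.e ξ z := fun z hz => by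
    rw [hξ z (Finset.mem_insert_of_mem (Finset.mem_union_right _ hz))]
    exact (Finset.le_sup (f := c.e γ) hz).trans_lt (haG z hz)
  have hξm : c.e ξ m = c.e α m :=
    (hξ m (Finset.mem_insert_self _ _)).trans (hae m hb₂m (hmδ.trans hδ))
  -- the minimum of `L(ξ, γ)` lies in its lower part `L(α, γ)`
  obtain ⟨w, -, hw⟩ := hγ.exists_isLeast hbξ (hξα.trans hαγ)
  have hwG : w ∈ c.lowerTrace α γ := by
    have hmem : w ∈ c.lowerTrace ξ γ := hw.1
    have hyξ : y ∈ c.lowerTrace ξ γ := by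
      rw [hs.lowerTrace_eq ξ hb₁ξ hξα]
      exact Finset.mem_union_left _ hy.1
    rw [hs.lowerTrace_eq ξ hb₁ξ hξα] at hmem
    exact (Finset.mem_union.1 hmem).resolve_right fun h =>
      ((hw.2 hyξ).trans_lt (hs.lt y hy.1)).not_ge (hs.le ξ hb₁ξ hξα w h)
  refine ⟨ξ, hξα, ?_⟩
  have h1 : c.osc ξ β = c.osc ξ α := by
    rw [hα.osc_eq_add hbξ hξα hx (hm ξ hmξ hξδ), if_neg fun h => h.2.ne hξm.symm,
      alternations_eq_zero_of_forall fun z hz => (hξF z hz).le]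
    omega
  have h2 : c.osc ξ γ = c.osc ξ α := by
    rw [hs.osc_eq_add hb₁ξ hξα hg (hm ξ hmξ hξδ), if_neg fun h => h.1.not_gt (hξG g hg.1),
      alternations_eq_zero_of_forall_not fun z hz => (hξG z hz).not_ge]
    omega
  have h3 : c.osc ξ β' = c.osc ξ γ + 1 := by
    rw [hγ.osc_eq_add hbξ (hξα.trans hαγ) (hF ▸ hx) hw, hF,
      if_pos ⟨((hξF x hx.1).trans (he x hx.1).symm).le, hξG w hwG⟩,
      alternations_eq_zero_of_forall fun z hz => ((hξF z hz).trans (he z hz).symm).le]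
    omega
  omega

/-- Every family of nodes `osc(·, β α)↾α`, `α` in a stationary set, contains a stationary antichain. -/
theorem exists_isStationary_osc_ne (c : CSequence) {S : Set Omega1} (hS : IsStationary S)
    {β : Omega1 → Omega1} (hβ : ∀ α ∈ S, α ≤ β α) :
    ∃ S' ⊆ S, IsStationary S' ∧
      ∀ α ∈ S', ∀ γ ∈ S', α < γ → ∃ ξ < α, c.osc ξ (β α) ≠ c.osc ξ (β γ) := by
  obtain ⟨E, hEclub, hE⟩ := c.exists_isClub_reflecting
  obtain ⟨K, hKclub, hK⟩ := c.exists_isClub_unbounded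
  -- for `α > x` in a stationary set, the splitting point of the walk from `β α` can be fixed
  have hfix : ∀ T ⊆ S, IsStationary T → (∀ α ∈ T, ∀ x < α, ∃ y, x < y ∧ y < α) → ∀ x,
      ∃ T' ⊆ T, IsStationary T' ∧ ∃ b, x ≤ b ∧ ∀ α ∈ T', c.Splits b α (β α) := by
    intro T hTS hT hlim x
    have hex : ∀ α, ∃ b, α ∈ T ∩ Ioi x → x ≤ b ∧ c.Splits b α (β α) := fun α => by
      by_cases h : α ∈ T ∩ Ioi x
      · obtain ⟨b, hb⟩ := c.exists_splits (hlim α h.1) (hβ α (hTS h.1)) h.2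
        exact ⟨b, fun _ => hb⟩
      · exact ⟨α, fun h' => absurd h' h⟩
    choose f hf using hex
    obtain ⟨b, hb⟩ := (hT.inter_isClub (isClub_Ioi x)).exists_fiber_of_regressive (b := f)
      fun α hα => c.subset_Iio α (hf α hα).2.mem_ladder
    refine ⟨_, fun α hα => hα.1.1, hb, b, ?_, fun α hα => hα.2 ▸ (hf α hα.1).2⟩
    obtain ⟨α, hα⟩ := hb.nonempty
    exact hα.2 ▸ (hf α hα.1).1
  obtain ⟨x₀⟩ : Nonempty Omega1 := inferInstance
  obtain ⟨S₁, hS₁S, hS₁, b, -, hb⟩ := hfix (S ∩ ({α | ∀ x < α, ∃ δ ∈ E, x < δ ∧ δ < α} ∩ K))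
    inter_subset_left
    (hS.inter_isClub ((isClub_limitPoints hEclub.isCofinal).inter cof_Omega1_ne hKclub))
    (fun α hα x hx => (hα.2.1 x hx).imp fun δ hδ => hδ.2) x₀
  -- there are only countably many possibilities for the restriction of `e_{β α}` to `L(α, β α)`
  obtain ⟨D, hD⟩ := hS₁.exists_fiber_of_countable
    (f := fun α => {q : Omega1 × ℕ | q.1 ∈ c.lowerTrace α (β α) ∧ q.2 = c.e (β α) q.1})
    ((Set.countable_ofPred_finite_subset
      ((countable_Iio b).prod (countable_univ (α := ℕ)))).mono (by
        rintro _ ⟨α, hα, rfl⟩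
        refine ⟨((c.lowerTrace α (β α)).finite_toSet.image
          fun z => (z, c.e (β α) z)).subset ?_, fun q hq => ⟨(hb α hα).lt _ hq.1, trivial⟩⟩
        rintro ⟨z, v⟩ ⟨hz, hv⟩
        exact ⟨z, hz, Prod.ext rfl hv.symm⟩))
  set S₂ : Set Omega1 := {α ∈ S₁ | _ = D}
  have hD' : ∀ α ∈ S₂, ∀ γ ∈ S₂, ∀ z ∈ c.lowerTrace α (β α),
      z ∈ c.lowerTrace γ (β γ) ∧ c.e (β γ) z = c.e (β α) z := by
    intro α hα γ hγ z hz
    have h1 : (z, c.e (β α) z) ∈ D := hα.2 ▸ ⟨hz, rfl⟩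
    rw [← hγ.2] at h1
    exact ⟨h1.1, h1.2.symm⟩
  have hL : ∀ α ∈ S₂, ∀ γ ∈ S₂, c.lowerTrace γ (β γ) = c.lowerTrace α (β α) :=
    fun α hα γ hγ => Finset.Subset.antisymm (fun z hz => (hD' γ hγ α hα z hz).1)
      fun z hz => (hD' α hα γ hγ z hz).1
  obtain ⟨α₀, hα₀⟩ := hD.nonempty
  rcases (c.lowerTrace α₀ (β α₀)).eq_empty_or_nonempty with h0 | hne
  · refine ⟨S₂, fun α hα => (hS₁S hα.1).1, hD, fun α hα γ hγ hαγ => ?_⟩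
    exact exists_osc_ne_of_empty hE hK (hS₁S hα.1).2.1 (hS₁S hα.1).2.2 hαγ (hb α hα.1)
      (hb γ hγ.1) ((hL α₀ hα₀ α hα).trans h0) ((hL α₀ hα₀ γ hγ).trans h0)
  · have hΞ : IsCofinal {a | ∀ z ∈ c.lowerTrace α₀ (β α₀), c.e a z = c.e (β α₀) z} := fun η => by
      obtain ⟨γ, hγ, hηγ⟩ := hD.exists_gt η
      exact ⟨β γ, fun z hz => (hD' α₀ hα₀ γ hγ z hz).2,
        hηγ.le.trans (hβ γ (hS₁S hγ.1).1)⟩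
    obtain ⟨x, hx⟩ := c.exists_forall_e_gt hΞ
    obtain ⟨S₃, hS₃S, hS₃, b', hxb, hb'⟩ := hfix S₂ (fun α hα => (hS₁S hα.1).1) hD
      (fun α hα x hx => ((hS₁S hα.1).2.1 x hx).imp fun δ hδ => hδ.2) x
    refine ⟨S₃, fun α hα => (hS₁S (hS₃S hα).1).1, hS₃, fun α hα γ hγ hαγ => ?_⟩
    have hLα := hL α₀ hα₀ α (hS₃S hα)
    refine exists_osc_ne_of_nonempty hE (hS₁S (hS₃S hα).1).2.1 hαγ (hb' α hα) (hb' γ hγ)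
      (hL α (hS₃S hα) γ (hS₃S hγ)) (hLα ▸ hne)
      (fun z hz => (hD' α (hS₃S hα) γ (hS₃S hγ) z hz).2) fun G hG N η => ?_
    obtain ⟨a, ha, hηa, haG⟩ := hx G (fun g hg => hxb.trans (hG g hg)) N η
    refine ⟨a, fun z hz => ?_, hηa, haG⟩
    rw [ha z (hLα ▸ hz), (hD' α (hS₃S hα) α₀ hα₀ z hz).2]

end CSequence

end MinimalWalk

theorem mainTheorem4 (c : MinimalWalk.CSequence)
    (S : Set MinimalWalk.Omega1) (hS : IsStationary S)
    (β : MinimalWalk.Omega1 → MinimalWalk.Omega1) (hβ : ∀ α ∈ S, α ≤ β α) :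
    ∃ S' : Set MinimalWalk.Omega1, S' ⊆ S ∧ IsStationary S' ∧
      ∀ α ∈ S', ∀ γ ∈ S', α < γ →
        ((c.oscSeq α).IsInitial ((c.oscSeq γ).restrict α) ↔
          ((c.oscSeq (β α)).restrict α).IsInitial ((c.oscSeq (β γ)).restrict γ)) := by
  obtain ⟨S₁, hS₁, hstat₁, h₁⟩ := c.exists_isStationary_osc_ne hS (β := id) fun α _ => le_rfl
  obtain ⟨S₂, hS₂, hstat₂, h₂⟩ := c.exists_isStationary_osc_ne hstat₁
    fun α hα => hβ α (hS₁ hα)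
  refine ⟨S₂, hS₂.trans hS₁, hstat₂, fun α hα γ hγ hαγ => iff_of_false ?_ ?_⟩
  · rintro ⟨_, h⟩
    obtain ⟨ξ, hξ, hne⟩ := h₁ α (hS₂ hα) γ (hS₂ hγ) hαγ
    exact hne (h ⟨ξ, hξ⟩)
  · rintro ⟨_, h⟩
    obtain ⟨ξ, hξ, hne⟩ := h₂ α hα γ hγ hαγ
    exact hne (h ⟨ξ, lt_min (hξ.trans_le (hβ α (hS₁ (hS₂ hα)))) hξ⟩)
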